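/- Fix integers $1\le q\le p$, a positive definite $p\times p$ matrix $C$ with unit diagonal, a vector $\beta\in\mathbb{R}^p$ with $\beta_j\neq 0$ if and only if $j\le q$, and $v>0$, none of which depends on $n$. Let $z_1,z_2,\dots$ be i.i.d. copies of a random row vector $\mathcal{X}=(X_1,\dots,X_p)$ with mean $0$, finite second moments and covariance matrix $C$, and let $\varepsilon_1,\varepsilon_2,\dots$ be i.i.d. $N(0,v)$, independent of $(z_i)_{i\ge 1}$. For each $n$ let $\bm{X}$ be the $n\times p$ design matrix with rows $x_i$ and columns $\bm{X}_j$ which is either (for all $n$) the matrix with rows $z_1,\dots,z_n$, or (for all $n$) this matrix with each column centred and then rescaled so that $\bm{X}_j^T\bm{X}_j=n$ (a constant column becoming zero). Let $y=\bm{X}\beta+(\varepsilon_1,\dots,\varepsilon_n)^T$. Write $Y=\mathcal{X}\beta+\varepsilon$ with $\varepsilon\sim N(0,v)$ independent of $\mathcal{X}$, and let $\varepsilon_{Y,-j}$ and $\varepsilon_{j,-j}$ be the errors of the best linear predictions of $Y$ and $X_j$ based on $\{X_k:k\ne j\}$. The semi-standard partial covariance (SPAC) is $\gamma_j=\rho_j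 s_j$, where $\rho_j=\mathrm{Corr}(\varepsilon_{Y,-j},\varepsilon_{j,-j})$ and $s_j=\sqrt{\mathrm{Var}(\varepsilon_{Y,-j})}$; put $\gamma=(\gamma_1,\dots,\gamma_p)$ and $\gamma_{(1)}=(\gamma_1,\dots,\gamma_q)^T$. Let $d_{jj}=(C^{-1})_{jj}$, and for each $n$ let $\hat d=(\hat d_{11},\dots,\hat d_{pp})$ be a random vector. For $\lambda\ge 0$ a SPAC-Lasso estimate $\hat\gamma(\lambda)$ is a minimizer over $g\in\mathbb{R}^p$ of $$\tfrac12\Big\|y-\sum_{j=1}^p \bm{X}_j\sqrt{\hat d_{jj}}\,g_j\Big\|^2+\lambda\sum_{j=1}^p\hat d_{jj}|g_j|.$$ Suppose that (C3) $\max_{1\le i\le n}x_ix_i^T=o_p(n)$, and that $\max_{1\le j\le p}|\hat d_{jj}-d_{jj}|=o_p(1/\sqrt n)$. If the SPAC-Lasso is general sign consistent, that is, if $$\lim_{n\to\infty}P\big(\text{there are } \lambda\ge 0 \text{ and a SPAC-Lasso estimate } \hat\gamma(\lambda) \text{ with } \mathrm{sign}(\hat\gamma(\lambda))=\mathrm{sign}(\gamma)\big)=1,$$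 then the transformed weak irrepresentable condition holds: $$\text{(C2)}\qquad \big|V(2)\,C_{21}\,C_{11}^{-1}\,V(1)^{-1}\,\mathrm{sign}(\gamma_{(1)})\big|\le \bm{1}\quad\text{(entrywise)},$$ where $C_{11}$ and $C_{21}$ are the blocks of $C$ with columns $1,\dots,q$ and rows $1,\dots,q$ and $q+1,\dots,p$, respectively, $V(1)=\mathrm{diag}(1/\sqrt{d_{11}},\dots,1/\sqrt{d_{qq}})$ and $V(2)=\mathrm{diag}(1/\sqrt{d_{q+1\,q+1}},\dots,1/\sqrt{d_{pp}})$. -/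

import Mathlib

open MeasureTheory ProbabilityTheory Filter Topology
open scoped NNReal ENNReal Matrix

noncomputable section

namespace SPAC

variable {Ω : Type*} [MeasurableSpace Ω]

/-- The covariance matrix of the random vector `𝒳 = (X₁, …, X_p)`. -/
def covMatrix {p : ℕ} (μ : Measure Ω) (𝒳 : Ω → Fin p → ℝ) : Matrix (Fin p) (Fin p) ℝ :=
  Matrix.of fun j k => covariance (fun ω => 𝒳 ω j) (fun ω => 𝒳 ω k) μ

/-- The coefficients of the best linear predictor of `W` based on
`X_{-j} = {X_k : k ≠ j}`, namely `Cov(X_{-j})⁻¹ Cov(X_{-j}, W)`. -/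
def predCoef {p : ℕ} (μ : Measure Ω) (𝒳 : Ω → Fin p → ℝ) (W : Ω → ℝ) (j : Fin p) :
    {k : Fin p // k ≠ j} → ℝ :=
  ((covMatrix μ 𝒳).toBlock (fun k => k ≠ j) (fun k => k ≠ j))⁻¹ *ᵥ
    fun k => covariance (fun ω => 𝒳 ω k) W μ

/-- The prediction error of `W` based on `X_{-j}` (all variables are centred, so there is no
intercept). -/
def predError {p : ℕ} (μ : Measure Ω) (𝒳 : Ω → Fin p → ℝ) (W : Ω → ℝ) (j : Fin p) : Ω → ℝ :=
  fun ω => W ω - ∑ k : {k : Fin p // k ≠ j}, predCoef μ 𝒳 W j k * 𝒳 ω k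

/-- The correlation of two real random variables. -/
def corr (μ : Measure Ω) (U W : Ω → ℝ) : ℝ :=
  covariance U W μ / (√(variance U μ) * √(variance W μ))

/-- The partial correlation `ρ_j = Corr(ε_Y, ε_j)` between `Y` and `X_j`: the correlation of the
prediction errors of `Y` and `X_j` based on `X_{-j}`. -/
def partialCorr {p : ℕ} (μ : Measure Ω) (𝒳 : Ω → Fin p → ℝ) (Y : Ω → ℝ) (j : Fin p) : ℝ :=
  corr μ (predError μ 𝒳 Y j) (predError μ 𝒳 (fun ω => 𝒳 ω j) j)

/-- `s_j`, the standard deviation of `Y` given `X_{-j}`, i.e. of the prediction error of `Y`. -/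
def residualSD {p : ℕ} (μ : Measure Ω) (𝒳 : Ω → Fin p → ℝ) (Y : Ω → ℝ) (j : Fin p) : ℝ :=
  √(variance (predError μ 𝒳 Y j) μ)

/-- The semi-standard partial covariance `γ_j = ρ_j s_j` between `Y` and `X_j`. -/
def spac {p : ℕ} (μ : Measure Ω) (𝒳 : Ω → Fin p → ℝ) (Y : Ω → ℝ) (j : Fin p) : ℝ :=
  partialCorr μ 𝒳 Y j * residualSD μ 𝒳 Y j

/-- The `n × p` matrix whose rows are the first `n` samples. -/
def sampleMatrix {p : ℕ} (Z : ℕ → Ω → Fin p → ℝ) (n : ℕ) (ω : Ω) : Matrix (Fin n) (Fin p) ℝ :=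
  Matrix.of fun i j => Z i ω j

/-- Column standardization: each column is centred and then scaled to squared norm `n`
(a constant column becomes zero). -/
def standardize {n p : ℕ} (A : Matrix (Fin n) (Fin p) ℝ) : Matrix (Fin n) (Fin p) ℝ :=
  Matrix.of fun i j =>
    (A i j - (∑ l, A l j) / n) / √((∑ l, (A l j - (∑ m, A m j) / n) ^ 2) / n)

/-- The SPAC-Lasso loss
`½ ‖y - ∑ j, X_j √d̂_jj γ_j‖² + lam ∑ j, d̂_jj |γ_j|`; `dh j` stands for `d̂_jj`. -/
def lassoLoss {n p : ℕ} (X : Matrix (Fin n) (Fin p) ℝ) (y : Fin n → ℝ) (dh : Fin p → ℝ)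
    (lam : ℝ) (g : Fin p → ℝ) : ℝ :=
  (1 / 2) * ∑ i, (y i - ∑ j, X i j * √(dh j) * g j) ^ 2 + lam * ∑ j, dh j * |g j|

/-- `g` is a SPAC-Lasso estimate with tuning parameter `lam`: a minimizer of the loss. -/
def IsSPACLasso {n p : ℕ} (X : Matrix (Fin n) (Fin p) ℝ) (y : Fin n → ℝ) (dh : Fin p → ℝ)
    (lam : ℝ) (g : Fin p → ℝ) : Prop :=
  ∀ g' : Fin p → ℝ, lassoLoss X y dh lam g ≤ lassoLoss X y dh lam g'

/-- General sign consistency: the probability that some `lam ≥ 0` gives a SPAC-Lasso estimate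
with the same signs as `γ` tends to `1`. -/
def GeneralSignConsistent {p : ℕ} (μ : Measure Ω) (X : (n : ℕ) → Ω → Matrix (Fin n) (Fin p) ℝ)
    (y : (n : ℕ) → Ω → Fin n → ℝ) (dh : ℕ → Ω → Fin p → ℝ) (γ : Fin p → ℝ) : Prop :=
  Tendsto
    (fun n => μ {ω | ∃ lam : ℝ, 0 ≤ lam ∧ ∃ g : Fin p → ℝ,
      IsSPACLasso (X n ω) (y n ω) (dh n ω) lam g ∧ ∀ j, Real.sign (g j) = Real.sign (γ j)})
    atTop (𝓝 1)

/-- `V = diag (√(1 / d_11), …, √(1 / d_pp))`, where `(d_ij) = C⁻¹`. -/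
def scaleMatrix {p : ℕ} (C : Matrix (Fin p) (Fin p) ℝ) : Matrix (Fin p) (Fin p) ℝ :=
  Matrix.diagonal fun j => √(1 / (C⁻¹) j j)

/-- The transformed weak irrepresentable condition
`|V(2) C₂₁ C₁₁⁻¹ V(1)⁻¹ sign(γ₍₁₎)| ≤ 1` (entrywise), block `1` being the first `q` indices and
block `2` the remaining `p - q`. -/
def WeakIrrepresentable {p : ℕ} (q : ℕ) (C : Matrix (Fin p) (Fin p) ℝ) (γ : Fin p → ℝ) : Prop :=
  ∀ j : {j : Fin p // ¬ (j : ℕ) < q},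
    |(((scaleMatrix C).toBlock (fun k => ¬ (k : ℕ) < q) (fun k => ¬ (k : ℕ) < q) *
        C.toBlock (fun k => ¬ (k : ℕ) < q) (fun k => (k : ℕ) < q) *
        (C.toBlock (fun k => (k : ℕ) < q) (fun k => (k : ℕ) < q))⁻¹ *
        ((scaleMatrix C).toBlock (fun k => (k : ℕ) < q) (fun k => (k : ℕ) < q))⁻¹) *ᵥ
      (fun k => Real.sign (γ k))) j| ≤ 1

end SPAC

end

/-!
Suppose (C2) fails at an inactive index `j`, in the direction of the sign `σ = ±1`. Let `u` be the
residual of the regression of column `j` of the design matrix on its active columns. As `u` is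
orthogonal to the active columns, `σ u · ε` equals `σ u · r` for the residual `r` of any fit whose
support is the active set, and for a minimizer with the right signs the optimality conditions at
`j` and at the active indices bound the latter by `lam` times the slack of the empirical
irrepresentable condition at `j`. Since the Gram matrix and `d̂` converge in probability to `C` and
`diag C⁻¹`, this slack is negative with probability tending to `1`, and so sign recovery forces
`σ u · ε ≤ 0`. But `u` is a function of the design, nonzero with probability tending to `1`, and
given the design `σ u · ε` is a centred Gaussian variable, positive with probability `1 / 2`.
-/

namespace SPAC

section OneVariable

lemma abs_le_of_forall_nonneg {a b c : ℝ} (h : ∀ t : ℝ, 0 ≤ -(t * a) + t ^ 2 * b + c * |t|) :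
    |a| ≤ c := by
  have hslope : ∀ s : ℝ, (∀ t > 0, s * t ≤ t ^ 2 * b + c * t) → s ≤ c := fun s hs => by
    have hlim : Tendsto (fun t : ℝ => t * b + c) (𝓝[>] 0) (𝓝 c) := by
      have : Continuous fun t : ℝ => t * b + c := by fun_prop
      simpa using (this.tendsto 0).mono_left nhdsWithin_le_nhds
    refine ge_of_tendsto hlim (eventually_mem_nhdsWithin.mono fun t (ht : 0 < t) => ?_)
    exact le_of_mul_le_mul_right (by linarith [hs t ht]) ht
  refine abs_le'.2 ⟨hslope a fun t ht => ?_, hslope (-a) fun t ht => ?_⟩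
  · linarith [abs_of_pos ht ▸ h t]
  · linarith [neg_sq t, abs_of_pos ht ▸ abs_neg t ▸ h (-t)]

lemma eq_mul_sign_of_forall_le {a b c x : ℝ} (hx : x ≠ 0)
    (h : ∀ t : ℝ, c * |x| ≤ -(t * a) + t ^ 2 * b + c * |x + t|) : a = c * Real.sign x := by
  have hmin : IsLocalMin (fun t : ℝ => -(t * a) + t ^ 2 * b + c * |x + t|) 0 :=
    Eventually.of_forall fun t => by simpa using h t
  have habs : HasDerivAt (fun t : ℝ => |x + t|) (Real.sign x) 0 := by
    refine HasDerivAt.comp_const_add x 0 ?_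
    rw [add_zero]
    rcases hx.lt_or_gt with hneg | hpos
    · simpa only [Real.sign_of_neg hneg] using hasDerivAt_abs_neg hneg
    · simpa only [Real.sign_of_pos hpos] using hasDerivAt_abs_pos hpos
  have hderiv := (((hasDerivAt_id (0 : ℝ)).mul_const a).neg.add
    ((hasDerivAt_pow 2 (0 : ℝ)).mul_const b)).add (habs.const_mul c)
  have := hmin.hasDerivAt_eq_zero hderiv
  norm_num at this
  linarith

end OneVariable

section Optimality

variable {n p : ℕ} {X : Matrix (Fin n) (Fin p) ℝ} {y : Fin n → ℝ} {dh g : Fin p → ℝ} {lam : ℝ}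

/-- The residual vector `y - ∑ j, X_j √d̂_jj g_j` of the SPAC-Lasso fit with coefficients `g`. -/
noncomputable def fitResidual (X : Matrix (Fin n) (Fin p) ℝ) (y : Fin n → ℝ) (dh g : Fin p → ℝ) :
    Fin n → ℝ :=
  y - X *ᵥ fun j => √(dh j) * g j

lemma lassoLoss_eq_fitResidual :
    lassoLoss X y dh lam g =
      1 / 2 * (fitResidual X y dh g ⬝ᵥ fitResidual X y dh g) + lam * ∑ j, dh j * |g j| := by
  simp only [lassoLoss, fitResidual, dotProduct, Matrix.mulVec, Pi.sub_apply, mul_assoc, sq]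

lemma fitResidual_add_single (j : Fin p) (t : ℝ) :
    fitResidual X y dh (g + Pi.single j t) =
      fitResidual X y dh g - (t * √(dh j)) • X.col j := by
  have h : (fun k => √(dh k) * (g + Pi.single j t : Fin p → ℝ) k) =
      (fun k => √(dh k) * g k) + Pi.single j (t * √(dh j)) := by
    ext k
    rcases eq_or_ne k j with rfl | hk
    · simp only [Pi.add_apply, Pi.single_eq_same]; ring
    · simp [hk]
  rw [fitResidual, fitResidual, h, Matrix.mulVec_add, Matrix.mulVec_single, op_smul_eq_smul,
    sub_add_eq_sub_sub]

lemma sum_mul_abs_add_single (j : Fin p) (t : ℝ) :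
    ∑ k, dh k * |(g + Pi.single j t : Fin p → ℝ) k| =
      ∑ k, dh k * |g k| + dh j * (|g j + t| - |g j|) := by
  rw [← sub_eq_iff_eq_add', ← Finset.sum_sub_distrib,
    Fintype.sum_eq_single j fun k hk => by simp [hk]]
  simp only [Pi.add_apply, Pi.single_eq_same]
  ring

lemma IsSPACLasso.mul_abs_le (h : IsSPACLasso X y dh lam g) (j : Fin p) (t : ℝ) :
    lam * dh j * |g j| ≤ -(t * (√(dh j) * (X.col j ⬝ᵥ fitResidual X y dh g))) +
      t ^ 2 * (1 / 2 * √(dh j) ^ 2 * (X.col j ⬝ᵥ X.col j)) + lam * dh j * |g j + t| := by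
  have := h (g + Pi.single j t)
  rw [lassoLoss_eq_fitResidual, lassoLoss_eq_fitResidual, fitResidual_add_single,
    sum_mul_abs_add_single] at this
  simp only [sub_dotProduct, dotProduct_sub, smul_dotProduct, dotProduct_smul, smul_eq_mul,
    dotProduct_comm (fitResidual X y dh g) (X.col j)] at this
  linarith

lemma IsSPACLasso.col_dotProduct_fitResidual (h : IsSPACLasso X y dh lam g) {j : Fin p}
    (hd : 0 < dh j) (hg : g j ≠ 0) :
    X.col j ⬝ᵥ fitResidual X y dh g = lam * √(dh j) * Real.sign (g j) := by
  have := eq_mul_sign_of_forall_le hg (h.mul_abs_le j)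
  have hsqrt := Real.sqrt_pos.2 hd
  refine mul_left_cancel₀ hsqrt.ne' (this.trans ?_)
  nth_rewrite 1 [← Real.mul_self_sqrt hd.le]
  ring

lemma IsSPACLasso.abs_col_dotProduct_fitResidual_le (h : IsSPACLasso X y dh lam g) {j : Fin p}
    (hd : 0 < dh j) (hg : g j = 0) :
    |X.col j ⬝ᵥ fitResidual X y dh g| ≤ lam * √(dh j) := by
  have hscore := abs_le_of_forall_nonneg fun t => by simpa [hg] using h.mul_abs_le j t
  have hsqrt := Real.sqrt_pos.2 hd
  rw [abs_mul, abs_of_pos hsqrt] at hscore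
  refine le_of_mul_le_mul_left (hscore.trans_eq ?_) hsqrt
  nth_rewrite 1 [← Real.mul_self_sqrt hd.le]
  ring

end Optimality

section Regression

variable {n : ℕ} {ι : Type*} [Fintype ι]

/-- The normalized Gram matrix `XᵀX / n`, the empirical counterpart of the covariance matrix. -/
noncomputable def gram (X : Matrix (Fin n) ι ℝ) : Matrix ι ι ℝ :=
  (n : ℝ)⁻¹ • (Xᵀ * X)

lemma transpose_mulVec_mulVec (X : Matrix (Fin n) ι ℝ) (a : ι → ℝ) :
    Xᵀ *ᵥ X *ᵥ a = (n : ℝ) • gram X *ᵥ a := by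
  rcases eq_or_ne n 0 with rfl | hn
  · ext k
    simp [Matrix.mulVec, dotProduct]
  · rw [gram, Matrix.smul_mulVec, smul_inv_smul₀ (Nat.cast_ne_zero.2 hn), Matrix.mulVec_mulVec]

variable [DecidableEq ι] {P : ι → Prop} [DecidablePred P] {j : ι}

/-- The coefficients, in terms of the second-moment matrix `S`, of the linear regression of the
variable `j` on the variables in `P`. -/
noncomputable def regCoef (P : ι → Prop) [DecidablePred P] (j : ι) (S : Matrix ι ι ℝ) :
    Subtype P → ℝ :=
  (S.toBlock P P)⁻¹ *ᵥ fun k => S k j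

/-- The coefficients of the residual of the linear regression of the variable `j` on the variables
in `P`, as a linear combination of all the variables. -/
noncomputable def regContrast (P : ι → Prop) [DecidablePred P] (j : ι) (S : Matrix ι ι ℝ) :
    ι → ℝ :=
  fun k => (Pi.single j 1 : ι → ℝ) k - if hk : P k then regCoef P j S ⟨k, hk⟩ else 0

/-- The residual of the least squares regression of column `j` of `X` on the columns in `P`. -/
noncomputable def regResidual (P : ι → Prop) [DecidablePred P] (j : ι) (X : Matrix (Fin n) ι ℝ) :
    Fin n → ℝ :=
  X *ᵥ regContrast P j (gram X)

lemma regContrast_self (hj : ¬ P j) (S : Matrix ι ι ℝ) : regContrast P j S j = 1 := by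
  simp [regContrast, hj]

lemma dotProduct_regContrast (S : Matrix ι ι ℝ) (f : ι → ℝ) :
    f ⬝ᵥ regContrast P j S = f j - (fun k : Subtype P => f k) ⬝ᵥ regCoef P j S := by
  have hsum : ∑ k, f k * (if hk : P k then regCoef P j S ⟨k, hk⟩ else 0) =
      ∑ k : Subtype P, f k * regCoef P j S k := by
    rw [← Fintype.sum_subtype_add_sum_subtype P,
      Fintype.sum_eq_zero (fun k : {k // ¬ P k} => f k * _) fun k => by rw [dif_neg k.2, mul_zero],
      add_zero]
    exact Finset.sum_congr rfl fun k _ => by rw [dif_pos k.2]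
  simp only [regContrast, dotProduct, mul_sub, Finset.sum_sub_distrib, hsum]
  congr 1
  exact dotProduct_single_one f j

lemma mulVec_regContrast_apply_eq_zero {S : Matrix ι ι ℝ} (hS : (S.toBlock P P).det ≠ 0) {k : ι}
    (hk : P k) : (S *ᵥ regContrast P j S) k = 0 := by
  have hnormal : (S.toBlock P P *ᵥ regCoef P j S) ⟨k, hk⟩ = S k j := by
    rw [regCoef, Matrix.mulVec_mulVec, Matrix.mul_nonsing_inv _ hS.isUnit, Matrix.one_mulVec]
  exact (dotProduct_regContrast S (S k)).trans (sub_eq_zero.2 hnormal.symm)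

lemma regResidual_dotProduct (X : Matrix (Fin n) ι ℝ) (r : Fin n → ℝ) :
    regResidual P j X ⬝ᵥ r = (Xᵀ *ᵥ r) ⬝ᵥ regContrast P j (gram X) := by
  rw [regResidual, dotProduct_comm, Matrix.dotProduct_mulVec, Matrix.mulVec_transpose]

lemma regResidual_dotProduct_mulVec {X : Matrix (Fin n) ι ℝ}
    (hS : ((gram X).toBlock P P).det ≠ 0) {c : ι → ℝ} (hc : ∀ k, ¬ P k → c k = 0) :
    regResidual P j X ⬝ᵥ X *ᵥ c = 0 := by
  rw [Matrix.dotProduct_mulVec, ← Matrix.mulVec_transpose, regResidual, transpose_mulVec_mulVec]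
  refine Finset.sum_eq_zero fun k _ => ?_
  by_cases hk : P k
  · rw [Pi.smul_apply, mulVec_regContrast_apply_eq_zero hS hk, smul_zero, zero_mul]
  · rw [hc k hk, mul_zero]

lemma regResidual_ne_zero (hj : ¬ P j) {X : Matrix (Fin n) ι ℝ} (hS : (gram X).det ≠ 0) :
    regResidual P j X ≠ 0 := by
  intro h0
  have hgram : gram X *ᵥ regContrast P j (gram X) = 0 := by
    rw [gram, Matrix.smul_mulVec, ← Matrix.mulVec_mulVec, ← gram]
    rw [regResidual] at h0
    rw [h0, Matrix.mulVec_zero, smul_zero]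
  have := congr_fun (Matrix.eq_zero_of_mulVec_eq_zero hS hgram) j
  exact one_ne_zero ((regContrast_self hj _).symm.trans this)

end Regression

section Irrepresentable

variable {n p : ℕ} {P : Fin p → Prop} [DecidablePred P] {j : Fin p}

/-- The statistic `∑ k ∈ P, √d_k s_k b_k`, where `b` is the vector of regression coefficients of the
variable `j` on the variables in `P`; at `S = C` and `d = diag C⁻¹` it is entry `j` of
`C₂₁ C₁₁⁻¹ V(1)⁻¹ s`, and the irrepresentable condition asks that it be at most `√d_j`. -/
noncomputable def irrepStat (P : Fin p → Prop) [DecidablePred P] (j : Fin p) (s : Fin p → ℝ)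
    (S : Matrix (Fin p) (Fin p) ℝ) (d : Fin p → ℝ) : ℝ :=
  (fun k : Subtype P => √(d k) * s k) ⬝ᵥ regCoef P j S

theorem mul_regResidual_dotProduct_nonpos {X : Matrix (Fin n) (Fin p) ℝ} {β dh g : Fin p → ℝ}
    {e : Fin n → ℝ} {lam σ : ℝ} (hβ : ∀ k, ¬ P k → β k = 0)
    (hS : ((gram X).toBlock P P).det ≠ 0) (hd : ∀ k, 0 < dh k) (hlam : 0 ≤ lam)
    (hlasso : IsSPACLasso X (X *ᵥ β + e) dh lam g) (hg : ∀ k, g k ≠ 0 ↔ P k) (hj : ¬ P j)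
    (hσ : |σ| ≤ 1)
    (hviol : √(dh j) ≤ σ * irrepStat P j (fun k => Real.sign (g k)) (gram X) dh) :
    σ * (regResidual P j X ⬝ᵥ e) ≤ 0 := by
  have hg0 : ∀ k, ¬ P k → g k = 0 := fun k hk => of_not_not fun hgk => hk ((hg k).1 hgk)
  set r := fitResidual X (X *ᵥ β + e) dh g with hr
  have hnoise : regResidual P j X ⬝ᵥ e = regResidual P j X ⬝ᵥ r := by
    have hr' : r = e + X *ᵥ (β - fun k => √(dh k) * g k) := by
      rw [hr, fitResidual, Matrix.mulVec_sub]; abel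
    rw [hr', dotProduct_add, regResidual_dotProduct_mulVec hS, add_zero]
    intro k hk
    rw [Pi.sub_apply, hβ k hk, hg0 k hk, mul_zero, sub_zero]
  have hscore : regResidual P j X ⬝ᵥ r =
      X.col j ⬝ᵥ r - lam * irrepStat P j (fun k => Real.sign (g k)) (gram X) dh := by
    rw [regResidual_dotProduct, dotProduct_regContrast, irrepStat, ← smul_eq_mul lam,
      ← smul_dotProduct]
    congr 2
    funext k
    exact (hlasso.col_dotProduct_fitResidual (hd k) ((hg k).2 k.2)).trans (mul_assoc _ _ _)
  have hj' : σ * (X.col j ⬝ᵥ r) ≤ lam * √(dh j) := calc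
    σ * (X.col j ⬝ᵥ r) ≤ |σ| * |X.col j ⬝ᵥ r| := (le_abs_self _).trans_eq (abs_mul _ _)
    _ ≤ |X.col j ⬝ᵥ r| := mul_le_of_le_one_left (abs_nonneg _) hσ
    _ ≤ lam * √(dh j) := hlasso.abs_col_dotProduct_fitResidual_le (hd j) (hg0 j hj)
  rw [hnoise, hscore, mul_sub]
  linarith [mul_le_mul_of_nonneg_left hviol hlam]

lemma inv_toBlock_scaleMatrix {C : Matrix (Fin p) (Fin p) ℝ} (hC : C.PosDef) :
    ((scaleMatrix C).toBlock P P)⁻¹ = Matrix.diagonal fun k : Subtype P => √(C⁻¹ k k) := by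
  rw [scaleMatrix, Matrix.toBlock_diagonal_self]
  refine Matrix.inv_eq_right_inv ?_
  rw [Matrix.diagonal_mul_diagonal, ← Matrix.diagonal_one]
  congr 1
  funext k
  have hk : 0 < C⁻¹ k k := hC.inv.diag_pos
  rw [← Real.sqrt_mul (one_div_nonneg.2 hk.le), one_div_mul_cancel hk.ne', Real.sqrt_one]

lemma mulVec_dotProduct_eq_irrepStat {C : Matrix (Fin p) (Fin p) ℝ} (hC : C.IsSymm)
    (s : Fin p → ℝ) (d : Fin p → ℝ) :
    (fun k : Subtype P => C j k) ⬝ᵥ (C.toBlock P P)⁻¹ *ᵥ (fun k : Subtype P => √(d k) * s k) =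
      irrepStat P j s C d := by
  have hinv : ((C.toBlock P P)⁻¹)ᵀ = (C.toBlock P P)⁻¹ := by
    rw [Matrix.transpose_nonsing_inv]
    congr 1
    ext k l
    exact hC.apply _ _
  rw [irrepStat, regCoef, Matrix.dotProduct_mulVec, dotProduct_comm, ← Matrix.mulVec_transpose,
    hinv]
  congr 2
  funext k
  exact hC.apply _ _

theorem weakIrrepresentable_iff {q : ℕ} {C : Matrix (Fin p) (Fin p) ℝ} (hC : C.PosDef)
    {γ : Fin p → ℝ} :
    WeakIrrepresentable q C γ ↔ ∀ j : Fin p, ¬ (j : ℕ) < q →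
      |irrepStat (fun k => (k : ℕ) < q) j (fun k => Real.sign (γ k)) C fun k => C⁻¹ k k| ≤
        √(C⁻¹ j j) := by
  have hsymm : C.IsSymm := by simpa using hC.isHermitian
  simp only [WeakIrrepresentable, Subtype.forall]
  refine forall₂_congr fun j hj => ?_
  have hdj : 0 < √(C⁻¹ j j) := Real.sqrt_pos.2 hC.inv.diag_pos
  rw [inv_toBlock_scaleMatrix hC, scaleMatrix, Matrix.toBlock_diagonal_self,
    ← mulVec_dotProduct_eq_irrepStat hsymm, ← Matrix.mulVec_mulVec, ← Matrix.mulVec_mulVec,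
    ← Matrix.mulVec_mulVec, Matrix.mulVec_diagonal, abs_mul, abs_of_nonneg (Real.sqrt_nonneg _),
    one_div, Real.sqrt_inv, inv_mul_le_one₀ hdj]
  simp only [Matrix.mulVec, dotProduct, Matrix.toBlock_apply, Matrix.diagonal_apply, ite_mul,
    zero_mul, Finset.sum_ite_eq, Finset.mem_univ, if_true]

end Irrepresentable

section Violation

variable {p : ℕ} {P : Fin p → Prop} [DecidablePred P] {j : Fin p} {s : Fin p → ℝ} {σ : ℝ}

/-- The pairs `(S, d)` of a Gram matrix and a scaling at which the active block of `S` and `S`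
itself are invertible, `d` is positive, and the irrepresentable condition fails at `j` in the
direction of the sign `σ`. -/
def violationSet (P : Fin p → Prop) [DecidablePred P] (j : Fin p) (s : Fin p → ℝ) (σ : ℝ) :
    Set (Matrix (Fin p) (Fin p) ℝ × (Fin p → ℝ)) :=
  {x | (x.1.toBlock P P).det ≠ 0 ∧ x.1.det ≠ 0 ∧ (∀ k, 0 < x.2 k) ∧
    √(x.2 j) < σ * irrepStat P j s x.1 x.2}

lemma continuousAt_irrepStat {x : Matrix (Fin p) (Fin p) ℝ × (Fin p → ℝ)}
    (hx : (x.1.toBlock P P).det ≠ 0) :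
    ContinuousAt (fun x : Matrix (Fin p) (Fin p) ℝ × (Fin p → ℝ) => irrepStat P j s x.1 x.2) x := by
  have hblock : Continuous fun x : Matrix (Fin p) (Fin p) ℝ × (Fin p → ℝ) => x.1.toBlock P P :=
    continuous_fst.matrix_submatrix _ _
  have hinv : ContinuousAt (fun x : Matrix (Fin p) (Fin p) ℝ × (Fin p → ℝ) =>
      (x.1.toBlock P P)⁻¹) x :=
    (continuousAt_matrix_inv _ (by simpa using continuousAt_inv₀ hx)).comp hblock.continuousAt
  have hentry : ∀ k l, ContinuousAt (fun x : Matrix (Fin p) (Fin p) ℝ × (Fin p → ℝ) =>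
      (x.1.toBlock P P)⁻¹ k l) x := fun k l =>
    (continuous_id.matrix_elem k l).continuousAt.comp hinv
  simp only [irrepStat, regCoef, dotProduct, Matrix.mulVec]
  fun_prop

lemma violationSet_mem_nhds {x : Matrix (Fin p) (Fin p) ℝ × (Fin p → ℝ)}
    (hx : x ∈ violationSet P j s σ) : violationSet P j s σ ∈ 𝓝 x := by
  obtain ⟨hblock, hdet, hpos, hlt⟩ := hx
  have hblockc : Continuous fun x : Matrix (Fin p) (Fin p) ℝ × (Fin p → ℝ) =>
      (x.1.toBlock P P).det := (continuous_fst.matrix_submatrix _ _).matrix_det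
  have hdetc : Continuous fun x : Matrix (Fin p) (Fin p) ℝ × (Fin p → ℝ) => x.1.det :=
    continuous_fst.matrix_det
  have hposc : ∀ k, Continuous fun x : Matrix (Fin p) (Fin p) ℝ × (Fin p → ℝ) => x.2 k :=
    fun k => by fun_prop
  exact inter_mem (hblockc.continuousAt.eventually_ne hblock) <|
    inter_mem (hdetc.continuousAt.eventually_ne hdet) <|
    inter_mem (eventually_all.2 fun k => (hposc k).continuousAt.eventually_const_lt (hpos k)) <|
    (hposc j).sqrt.continuousAt.eventually_lt
      ((continuousAt_irrepStat hblock).const_mul σ) hlt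

lemma exists_sign_mem_violationSet {C : Matrix (Fin p) (Fin p) ℝ} (hC : C.PosDef)
    (h : √(C⁻¹ j j) < |irrepStat P j s C fun k => C⁻¹ k k|) :
    ∃ σ : ℝ, |σ| = 1 ∧ (C, fun k => C⁻¹ k k) ∈ violationSet P j s σ := by
  have hblock : (C.toBlock P P).PosDef := hC.submatrix Subtype.val_injective
  have hmem : ∀ σ : ℝ, √(C⁻¹ j j) < σ * irrepStat P j s C (fun k => C⁻¹ k k) →
      (C, fun k => C⁻¹ k k) ∈ violationSet P j s σ := fun σ hσ =>
    ⟨hblock.det_pos.ne', hC.det_pos.ne', fun _ => hC.inv.diag_pos, hσ⟩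
  rcases lt_abs.1 h with hpos | hneg
  · exact ⟨1, abs_one, hmem 1 (by rwa [one_mul])⟩
  · exact ⟨-1, by simp, hmem (-1) (by rwa [neg_one_mul])⟩

end Violation

section InProbability

variable {Ω ι α : Type*} [MeasurableSpace Ω] {μ : Measure Ω} {l : Filter ι}

lemma tendsto_measure_zero_mono {A B : ι → Set Ω} (hB : Tendsto (fun i => μ (B i)) l (𝓝 0))
    (hAB : ∀ i, A i ⊆ B i) : Tendsto (fun i => μ (A i)) l (𝓝 0) :=
  tendsto_of_tendsto_of_tendsto_of_le_of_le tendsto_const_nhds hB (fun _ => zero_le)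
    fun i => measure_mono (hAB i)

/-- Convergence in probability to a constant, for random elements of a topological space. It agrees
with `TendstoInMeasure` on metric spaces, but is also available for matrices, which carry no
canonical metric. -/
def TendstoInProb [TopologicalSpace α] (μ : Measure Ω) (f : ι → Ω → α) (l : Filter ι) (a : α) :
    Prop :=
  ∀ U ∈ 𝓝 a, Tendsto (fun i => μ {ω | f i ω ∉ U}) l (𝓝 0)

lemma tendstoInProb_of_tendstoInMeasure [PseudoEMetricSpace α] {f : ι → Ω → α} {a : α}
    (h : TendstoInMeasure μ f l fun _ => a) : TendstoInProb μ f l a := by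
  intro U hU
  obtain ⟨r, hr, hball⟩ := EMetric.mem_nhds_iff.1 hU
  refine tendsto_measure_zero_mono (h r hr) fun i ω hω => ?_
  exact not_lt.1 fun hlt => hω (hball (Metric.mem_eball.2 hlt))

lemma TendstoInProb.prodMk {α' : Type*} [TopologicalSpace α] [TopologicalSpace α']
    {f : ι → Ω → α} {g : ι → Ω → α'} {a : α} {b : α'}
    (hf : TendstoInProb μ f l a) (hg : TendstoInProb μ g l b) :
    TendstoInProb μ (fun i ω => (f i ω, g i ω)) l (a, b) := by
  intro W hW
  obtain ⟨U, hU, V, hV, hsub⟩ := mem_nhds_prod_iff.1 hW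
  have hadd := (hf U hU).add (hg V hV)
  rw [add_zero] at hadd
  refine tendsto_of_tendsto_of_tendsto_of_le_of_le tendsto_const_nhds hadd
    (fun i => zero_le) fun i => (measure_mono fun ω hω => ?_).trans (measure_union_le _ _)
  exact or_iff_not_and_not.2 fun hmem =>
    hω (hsub ⟨not_not.1 hmem.1, not_not.1 hmem.2⟩)

lemma tendstoInProb_pi {κ : Type*} [Finite κ] {π : κ → Type*} [∀ k, TopologicalSpace (π k)]
    {f : ι → Ω → ∀ k, π k} {a : ∀ k, π k}
    (h : ∀ k, TendstoInProb μ (fun i ω => f i ω k) l (a k)) : TendstoInProb μ f l a := by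
  have := Fintype.ofFinite κ
  intro W hW
  rw [nhds_pi, mem_pi'] at hW
  obtain ⟨I, U, hU, hsub⟩ := hW
  have hsum := tendsto_finsetSum Finset.univ fun k _ => h k (U k) (hU k)
  rw [Finset.sum_const_zero] at hsum
  refine tendsto_of_tendsto_of_tendsto_of_le_of_le tendsto_const_nhds hsum
    (fun i => zero_le) fun i =>
      (measure_mono fun ω hω => ?_).trans (measure_iUnion_fintype_le μ _)
  by_contra hmem
  exact hω (hsub fun k _ => not_not.1 fun hk => hmem (Set.mem_iUnion.2 ⟨k, hk⟩))

lemma tendsto_measure_one_of_compl_subset [IsProbabilityMeasure μ] {A B : ι → Set Ω}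
    (hB : Tendsto (fun i => μ (B i)) l (𝓝 0)) (hAB : ∀ i, (A i)ᶜ ⊆ B i) :
    Tendsto (fun i => μ (A i)) l (𝓝 1) := by
  have hlim := ENNReal.Tendsto.sub (tendsto_const_nhds (x := (1 : ℝ≥0∞))) hB
    (Or.inl ENNReal.one_ne_top)
  rw [tsub_zero] at hlim
  refine tendsto_of_tendsto_of_tendsto_of_le_of_le hlim tendsto_const_nhds (fun i => ?_)
    fun i => prob_le_one
  refine tsub_le_iff_right.2 ?_
  rw [← measure_univ (μ := μ), ← Set.union_compl_self (A i)]
  exact (measure_union_le _ _).trans (add_le_add_right (measure_mono (hAB i)) _)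

lemma tendsto_measure_zero_of_inter [IsProbabilityMeasure μ] {E F : ι → Set Ω}
    (hF : ∀ i, MeasurableSet (F i)) (hE : Tendsto (fun i => μ (E i)) l (𝓝 1))
    (hEF : Tendsto (fun i => μ (E i ∩ F i)) l (𝓝 0)) : Tendsto (fun i => μ (F i)) l (𝓝 0) := by
  have hle : ∀ i, μ (F i) ≤ 1 + μ (E i ∩ F i) - μ (E i) := fun i => by
    refine ENNReal.le_sub_of_add_le_left (measure_ne_top μ _) ?_
    rw [← measure_union_add_inter _ (hF i)]
    exact add_le_add_left prob_le_one _
  have hlim := ENNReal.Tendsto.sub (tendsto_const_nhds.add hEF) hE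
    (Or.inr ENNReal.one_ne_top) (a := 1 + 0)
  rw [add_zero, tsub_self] at hlim
  exact tendsto_of_tendsto_of_tendsto_of_le_of_le tendsto_const_nhds hlim (fun i => zero_le) hle

end InProbability

section HalfSpace

variable {Ω κ : Type*} [MeasurableSpace Ω] {μ : Measure Ω} {n : ℕ} [Fintype κ]

lemma measurableSet_dotProduct_pos :
    MeasurableSet {z : (κ → ℝ) × (κ → ℝ) | 0 < z.1 ⬝ᵥ z.2} :=
  measurableSet_lt measurable_const (by simp only [dotProduct]; fun_prop)

lemma mul_measure_ne_zero_le_of_indepFun [IsFiniteMeasure μ] {U E : Ω → κ → ℝ}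
    (hU : Measurable U) (hE : Measurable E) (hUE : IndepFun U E μ) {c : ℝ≥0∞}
    (hc : ∀ a : κ → ℝ, a ≠ 0 → c ≤ μ {ω | 0 < a ⬝ᵥ E ω}) :
    c * μ {ω | U ω ≠ 0} ≤ μ {ω | 0 < U ω ⬝ᵥ E ω} := by
  have hne : MeasurableSet {a : κ → ℝ | a ≠ 0} := (measurableSet_singleton 0).compl
  have hpos : ∀ a : κ → ℝ, a ≠ 0 → c ≤ μ.map E (Prod.mk a ⁻¹' {z | 0 < z.1 ⬝ᵥ z.2}) :=
    fun a ha => by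
      rw [Measure.map_apply hE (measurable_prodMk_left measurableSet_dotProduct_pos)]
      exact hc a ha
  calc c * μ {ω | U ω ≠ 0}
      = ∫⁻ a, {a | a ≠ 0}.indicator (fun _ => c) a ∂(μ.map U) := by
        rw [lintegral_indicator_const hne, Measure.map_apply hU hne]; rfl
    _ ≤ ∫⁻ a, μ.map E (Prod.mk a ⁻¹' {z | 0 < z.1 ⬝ᵥ z.2}) ∂(μ.map U) :=
        lintegral_mono fun a => Set.indicator_le (fun a ha => hpos a ha) a
    _ = μ.map (fun ω => (U ω, E ω)) {z | 0 < z.1 ⬝ᵥ z.2} := by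
        rw [(indepFun_iff_map_prod_eq_prod_map_map hU.aemeasurable hE.aemeasurable).1 hUE,
          Measure.prod_apply measurableSet_dotProduct_pos]
    _ = μ {ω | 0 < U ω ⬝ᵥ E ω} := Measure.map_apply (hU.prodMk hE) measurableSet_dotProduct_pos

lemma measurable_matrix_inv [DecidableEq κ] :
    Measurable fun (x : κ → κ → ℝ) k l => (Matrix.of x)⁻¹ k l := by
  have hof : Continuous fun x : κ → κ → ℝ => Matrix.of x := continuous_id
  have hdet : Measurable fun x : κ → κ → ℝ => (Matrix.of x).det := hof.matrix_det.measurable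
  have hadj : ∀ k l, Measurable fun x : κ → κ → ℝ => (Matrix.of x).adjugate k l := fun k l =>
    (hof.matrix_adjugate.matrix_elem k l).measurable
  simp only [Matrix.inv_def, Ring.inverse_eq_inv', Matrix.smul_apply, smul_eq_mul]
  fun_prop

variable {ι : Type*}

lemma measurable_gram : Measurable fun (x : Fin n → ι → ℝ) k l => gram (Matrix.of x) k l := by
  simp only [gram, Matrix.smul_apply, Matrix.mul_apply, Matrix.transpose_apply, Matrix.of_apply]
  fun_prop

variable [Fintype ι] [DecidableEq ι] {P : ι → Prop} [DecidablePred P] {j : ι}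

lemma measurable_regContrast :
    Measurable fun S : ι → ι → ℝ => regContrast P j (Matrix.of S) := by
  have hblock : Measurable fun (S : ι → ι → ℝ) (k l : Subtype P) => S k l := by fun_prop
  have hinv : ∀ k l, Measurable fun S : ι → ι → ℝ => ((Matrix.of S).toBlock P P)⁻¹ k l :=
    fun k l => measurable_pi_iff.1 (measurable_pi_iff.1 (measurable_matrix_inv.comp hblock) k) l
  have hcoef : ∀ k, Measurable fun S : ι → ι → ℝ => regCoef P j (Matrix.of S) k := fun k =>
    Finset.measurable_sum _ fun l _ =>
      (hinv k l).mul ((measurable_pi_apply j).comp (measurable_pi_apply l.1))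
  refine measurable_pi_lambda _ fun k => ?_
  by_cases hk : P k
  · simpa only [regContrast, dif_pos hk] using (hcoef _).const_sub _
  · simp only [regContrast, dif_neg hk, measurable_const]

lemma measurable_regResidual :
    Measurable fun x : Fin n → ι → ℝ => regResidual P j (Matrix.of x) := by
  have hcontrast : Measurable fun x : Fin n → ι → ℝ => regContrast P j (gram (Matrix.of x)) :=
    measurable_regContrast.comp measurable_gram
  refine measurable_pi_lambda _ fun i => ?_
  simp only [regResidual, Matrix.mulVec, dotProduct, Matrix.of_apply]
  fun_prop

end HalfSpace

section Gaussian

lemma gaussianReal_zero_Ioi {v : ℝ≥0} (hv : v ≠ 0) : gaussianReal 0 v (Set.Ioi 0) = 2⁻¹ := by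
  have := nullSingletonClass_gaussianReal (μ := 0) hv
  have hsymm : gaussianReal 0 v (Set.Iio 0) = gaussianReal 0 v (Set.Ioi 0) := by
    have hneg : (gaussianReal 0 v).map (fun x => -x) = gaussianReal 0 v := by
      rw [gaussianReal_map_neg, neg_zero]
    nth_rewrite 1 [← hneg]
    rw [Measure.map_apply measurable_neg measurableSet_Iio, Set.neg_preimage, Set.neg_Iio,
      neg_zero]
  have htotal : gaussianReal 0 v (Set.Ioi 0) + gaussianReal 0 v (Set.Iio 0) = 1 := by
    rw [measure_congr (Iio_ae_eq_Iic (μ := gaussianReal 0 v) (a := (0 : ℝ))), ← Set.compl_Ioi]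
    exact prob_add_prob_compl measurableSet_Ioi
  rw [hsymm, ← mul_two] at htotal
  exact ENNReal.eq_inv_of_mul_eq_one_left htotal

variable {Ω κ : Type*} [MeasurableSpace Ω] {μ : Measure Ω}

lemma hasLaw_sum_gaussianReal {f : κ → Ω → ℝ} (hindep : iIndepFun f μ) {m : κ → ℝ} {w : κ → ℝ≥0}
    (hlaw : ∀ i, HasLaw (f i) (gaussianReal (m i) (w i)) μ) (s : Finset κ) :
    HasLaw (∑ i ∈ s, f i) (gaussianReal (∑ i ∈ s, m i) (∑ i ∈ s, w i)) μ := by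
  have := hindep.isProbabilityMeasure
  have hmeas : ∀ i, AEMeasurable (f i) μ := fun i => (hlaw i).aemeasurable
  classical
  induction s using Finset.induction_on with
  | empty =>
    rw [Finset.sum_empty, Finset.sum_empty, Finset.sum_empty, gaussianReal_zero_var]
    exact hasLaw_dirac_of_ae_eq ae_eq_rfl
  | insert i s hi ih =>
    simp only [Finset.sum_insert hi]
    exact ⟨(hmeas i).add ih.aemeasurable, gaussianReal_add_gaussianReal_of_indepFun
      (hindep.indepFun_finsetSum_of_notMem₀ hmeas hi).symm (hlaw i).map_eq ih.map_eq⟩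

lemma measure_dotProduct_pos_of_gaussian [Fintype κ] {e : κ → Ω → ℝ} (hindep : iIndepFun e μ)
    {v : ℝ≥0} (hv : v ≠ 0) (hlaw : ∀ i, HasLaw (e i) (gaussianReal 0 v) μ) {a : κ → ℝ}
    (ha : a ≠ 0) : μ {ω | 0 < a ⬝ᵥ fun i => e i ω} = 2⁻¹ := by
  have hsum := hasLaw_sum_gaussianReal
    (hindep.comp (fun i x => a i * x) fun i => measurable_const_mul (a i))
    (fun i => gaussianReal_const_mul (hlaw i) (a i)) Finset.univ
  simp only [mul_zero, Finset.sum_const_zero] at hsum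
  have hvar : ∑ i, (.mk (a i ^ 2) (sq_nonneg _) * v : ℝ≥0) ≠ 0 := by
    obtain ⟨i, hi⟩ := Function.ne_iff.1 ha
    refine fun h0 => mul_ne_zero ?_ hv (Finset.sum_eq_zero_iff.1 h0 i (Finset.mem_univ i))
    exact fun h => pow_ne_zero 2 hi (congr_arg NNReal.toReal h)
  rw [← gaussianReal_zero_Ioi hvar, ← hsum.map_eq,
    Measure.map_apply_of_aemeasurable hsum.aemeasurable measurableSet_Ioi]
  congr 1
  ext ω
  simp [dotProduct]

end Gaussian

section General

variable {Ω : Type*} [MeasurableSpace Ω] {p : ℕ}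

lemma dotProduct_noise_nonpos_of_mem_violationSet {n : ℕ} {P : Fin p → Prop} [DecidablePred P]
    {X : Matrix (Fin n) (Fin p) ℝ} {β dh γ g : Fin p → ℝ} {e : Fin n → ℝ} {lam σ : ℝ} {j : Fin p}
    (hβ : ∀ k, ¬ P k → β k = 0) (hγ : ∀ k, γ k ≠ 0 ↔ P k) (hj : ¬ P j) (hσ : |σ| = 1)
    (hmem : (gram X, dh) ∈ violationSet P j (fun k => Real.sign (γ k)) σ) (hlam : 0 ≤ lam)
    (hlasso : IsSPACLasso X (X *ᵥ β + e) dh lam g)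
    (hsign : ∀ k, Real.sign (g k) = Real.sign (γ k)) :
    (σ • regResidual P j X) ⬝ᵥ e ≤ 0 := by
  obtain ⟨hblock, -, hpos, hlt⟩ := hmem
  have hg : ∀ k, g k ≠ 0 ↔ P k := fun k => by
    rw [← hγ, Ne, ← Real.sign_eq_zero_iff, hsign, Real.sign_eq_zero_iff]
  rw [smul_dotProduct, smul_eq_mul]
  refine mul_regResidual_dotProduct_nonpos hβ hblock hpos hlam hlasso hg hj hσ.le ?_
  simp only [hsign]
  exact hlt.le

end General

section Covariates

variable {Ω : Type*} [MeasurableSpace Ω] {μ : Measure Ω} {p : ℕ} {W : Ω → Fin p → ℝ} {e : Ω → ℝ}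

lemma covariance_dotProduct [IsFiniteMeasure μ] (hL2 : ∀ j, MemLp (fun ω => W ω j) 2 μ)
    (a b : Fin p → ℝ) :
    covariance (fun ω => W ω ⬝ᵥ a) (fun ω => W ω ⬝ᵥ b) μ = a ⬝ᵥ covMatrix μ W *ᵥ b := by
  simp only [dotProduct, Matrix.mulVec, Finset.mul_sum, covMatrix, Matrix.of_apply]
  rw [covariance_fun_sum_fun_sum (fun i => (hL2 i).mul_const _) fun i => (hL2 i).mul_const _]
  simp only [covariance_mul_const_left, covariance_mul_const_right]
  exact Finset.sum_congr rfl fun i _ => Finset.sum_congr rfl fun k _ => by ring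

lemma predError_self (j : Fin p) :
    predError μ W (fun ω => W ω j) j =
      fun ω => W ω ⬝ᵥ regContrast (fun k => k ≠ j) j (covMatrix μ W) := by
  funext ω
  rw [dotProduct_regContrast, dotProduct_comm]
  rfl

lemma memLp_predError_self (hL2 : ∀ j, MemLp (fun ω => W ω j) 2 μ) (j : Fin p) :
    MemLp (predError μ W (fun ω => W ω j) j) 2 μ := by
  rw [predError_self]
  exact memLp_finsetSum _ fun k _ => (hL2 k).mul_const _

lemma variance_predError_self_pos [IsFiniteMeasure μ] (hL2 : ∀ j, MemLp (fun ω => W ω j) 2 μ)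
    (hpos : (covMatrix μ W).PosDef) (j : Fin p) :
    0 < variance (predError μ W (fun ω => W ω j) j) μ := by
  have hself := regContrast_self (P := fun k => k ≠ j) (not_not.2 rfl) (covMatrix μ W)
  rw [← covariance_self (memLp_predError_self hL2 j).aemeasurable, predError_self,
    covariance_dotProduct hL2]
  exact hpos.dotProduct_mulVec_pos fun h0 => one_ne_zero (hself.symm.trans (congr_fun h0 j))

lemma predCoef_linear_model [IsFiniteMeasure μ] (hL2 : ∀ j, MemLp (fun ω => W ω j) 2 μ)
    (hpos : (covMatrix μ W).PosDef) (he : MemLp e 2 μ)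
    (hcov : ∀ k, covariance (fun ω => W ω k) e μ = 0) (β : Fin p → ℝ) (j : Fin p) :
    predCoef μ W (fun ω => ∑ k, W ω k * β k + e ω) j =
      (fun k : {k // k ≠ j} => β k) + β j • predCoef μ W (fun ω => W ω j) j := by
  set B := (covMatrix μ W).toBlock (fun k => k ≠ j) (fun k => k ≠ j)
  have hB : B.PosDef := hpos.submatrix Subtype.val_injective
  have hcovY : ∀ k, covariance (fun ω => W ω k) (fun ω => ∑ l, W ω l * β l + e ω) μ =
      ∑ l, covMatrix μ W k l * β l := fun k => by
    refine (covariance_add_right (hL2 k)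
      (memLp_finsetSum Finset.univ fun l _ => (hL2 l).mul_const (β l)) he).trans ?_
    rw [hcov, add_zero, covariance_fun_sum_right (fun l => (hL2 l).mul_const (β l)) (hL2 k)]
    exact Finset.sum_congr rfl fun l _ => covariance_mul_const_right _
  have hnormal : (fun k : {k // k ≠ j} =>
      covariance (fun ω => W ω k) (fun ω => ∑ l, W ω l * β l + e ω) μ) =
      B *ᵥ (fun k : {k // k ≠ j} => β k) +
        β j • fun k : {k // k ≠ j} => covariance (fun ω => W ω k) (fun ω => W ω j) μ := by
    funext k
    rw [hcovY, Fintype.sum_eq_add_sum_subtype_ne _ j, add_comm, mul_comm]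
    rfl
  rw [predCoef, predCoef, hnormal, Matrix.mulVec_add, Matrix.mulVec_mulVec,
    Matrix.nonsing_inv_mul _ hB.det_pos.ne'.isUnit, Matrix.one_mulVec, Matrix.mulVec_smul]

lemma predError_linear_model [IsFiniteMeasure μ] (hL2 : ∀ j, MemLp (fun ω => W ω j) 2 μ)
    (hpos : (covMatrix μ W).PosDef) (he : MemLp e 2 μ)
    (hcov : ∀ k, covariance (fun ω => W ω k) e μ = 0) (β : Fin p → ℝ) (j : Fin p) :
    predError μ W (fun ω => ∑ k, W ω k * β k + e ω) j =
      fun ω => β j * predError μ W (fun ω => W ω j) j ω + e ω := by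
  funext ω
  simp only [predError, predCoef_linear_model hL2 hpos he hcov, Pi.add_apply, Pi.smul_apply,
    smul_eq_mul, add_mul, Finset.sum_add_distrib, mul_sub, Finset.mul_sum]
  rw [Fintype.sum_eq_add_sum_subtype_ne _ j]
  simp only [mul_assoc, mul_comm (W ω _) (β _)]
  ring

lemma covariance_predError_self_right [IsFiniteMeasure μ]
    (hL2 : ∀ j, MemLp (fun ω => W ω j) 2 μ) (he : MemLp e 2 μ)
    (hcov : ∀ k, covariance (fun ω => W ω k) e μ = 0) (j : Fin p) :
    covariance (predError μ W (fun ω => W ω j) j) e μ = 0 := by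
  rw [predError_self]
  simp only [dotProduct]
  rw [covariance_fun_sum_left (fun k => (hL2 k).mul_const _) he]
  exact Finset.sum_eq_zero fun k _ => by rw [covariance_mul_const_left, hcov, zero_mul]

theorem spac_ne_zero_iff [IsFiniteMeasure μ] (hL2 : ∀ j, MemLp (fun ω => W ω j) 2 μ)
    (hpos : (covMatrix μ W).PosDef) (he : MemLp e 2 μ) (hvar : 0 < variance e μ)
    (hcov : ∀ k, covariance (fun ω => W ω k) e μ = 0) (β : Fin p → ℝ) (j : Fin p) :
    spac μ W (fun ω => ∑ k, W ω k * β k + e ω) j ≠ 0 ↔ β j ≠ 0 := by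
  have hself := memLp_predError_self hL2 j
  have hselfpos := variance_predError_self_pos hL2 hpos j
  have horth := covariance_predError_self_right hL2 he hcov j
  rw [spac, partialCorr, residualSD, corr, predError_linear_model hL2 hpos he hcov]
  set U := predError μ W (fun ω => W ω j) j
  have hUL2 : MemLp (fun ω => β j * U ω) 2 μ := hself.const_mul _
  have hcovYU : covariance (fun ω => β j * U ω + e ω) U μ = β j * variance U μ := by
    refine (covariance_add_left hUL2 he hself).trans ?_
    rw [covariance_const_mul_left, covariance_self hself.aemeasurable, covariance_comm, horth,
      add_zero]
  have hvarY : 0 < variance (fun ω => β j * U ω + e ω) μ := by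
    rw [variance_fun_add hUL2 he, covariance_const_mul_left, horth, mul_zero, mul_zero, add_zero]
    exact add_pos_of_nonneg_of_pos (variance_nonneg _ _) hvar
  have hsdY := (Real.sqrt_pos.2 hvarY).ne'
  have hsdU := (Real.sqrt_pos.2 hselfpos).ne'
  rw [hcovYU, mul_ne_zero_iff, div_ne_zero_iff, mul_ne_zero_iff, mul_ne_zero_iff]
  exact ⟨fun h => h.1.1.1, fun h => ⟨⟨⟨h, hselfpos.ne'⟩, hsdY, hsdU⟩, hsdY⟩⟩

theorem spac_gaussian_ne_zero_iff (hL2 : ∀ j, MemLp (fun ω => W ω j) 2 μ)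
    (hpos : (covMatrix μ W).PosDef) {v : ℝ≥0} (hv : v ≠ 0) (he : HasLaw e (gaussianReal 0 v) μ)
    (hWe : IndepFun W e μ) (β : Fin p → ℝ) (j : Fin p) :
    spac μ W (fun ω => ∑ k, W ω k * β k + e ω) j ≠ 0 ↔ β j ≠ 0 := by
  have := he.isProbabilityMeasure
  have heL2 : MemLp e 2 μ := he.hasGaussianLaw.memLp_two
  have hvar : 0 < variance e μ := by
    rw [he.variance_eq, variance_id_gaussianReal]
    exact NNReal.coe_pos.2 (pos_iff_ne_zero.2 hv)
  exact spac_ne_zero_iff hL2 hpos heL2 hvar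
    (fun k => (hWe.comp (measurable_pi_apply k) measurable_id).covariance_eq_zero (hL2 k) heL2) β j

end Covariates

section Design

variable {Ω : Type*} {n p : ℕ} {Z : ℕ → Ω → Fin p → ℝ}

lemma sum_centered_mul (a b : Fin n → ℝ) :
    (∑ i, (a i - (∑ l, a l) / n) * (b i - (∑ l, b l) / n)) / n =
      (∑ i, a i * b i) / n - (∑ l, a l) / n * ((∑ l, b l) / n) := by
  rcases eq_or_ne n 0 with rfl | hn
  · simp
  have hn' : (n : ℝ) ≠ 0 := Nat.cast_ne_zero.2 hn
  have hexpand : ∑ i, (a i - (∑ l, a l) / n) * (b i - (∑ l, b l) / n) =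
      ∑ i, a i * b i - (∑ l, a l) * ((∑ l, b l) / n) := by
    simp only [sub_mul, mul_sub, Finset.sum_sub_distrib, ← Finset.sum_mul, ← Finset.mul_sum,
      Finset.sum_const, Finset.card_univ, Fintype.card_fin, nsmul_eq_mul]
    field_simp
    ring
  rw [hexpand]
  field_simp

lemma gram_apply {ι : Type*} (A : Matrix (Fin n) ι ℝ) (j k : ι) :
    gram A j k = (∑ i, A i j * A i k) / n := by
  rw [gram, Matrix.smul_apply, Matrix.mul_apply, smul_eq_mul, inv_mul_eq_div]
  rfl

lemma gram_standardize (A : Matrix (Fin n) (Fin p) ℝ) (j k : Fin p) :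
    gram (standardize A) j k =
      (gram A j k - (∑ l, A l j) / n * ((∑ l, A l k) / n)) /
        (√(gram A j j - (∑ l, A l j) / n * ((∑ l, A l j) / n)) *
          √(gram A k k - (∑ l, A l k) / n * ((∑ l, A l k) / n))) := by
  rw [gram_apply, gram_apply, gram_apply, gram_apply, ← sum_centered_mul fun i => A i j,
    ← sum_centered_mul (fun i => A i j) fun i => A i j,
    ← sum_centered_mul (fun i => A i k) fun i => A i k, div_right_comm]
  simp only [standardize, Matrix.of_apply, ← sq, div_mul_div_comm, ← Finset.sum_div]

lemma measurable_standardize :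
    Measurable fun (x : Fin n → Fin p → ℝ) i j => standardize (Matrix.of x) i j := by
  refine measurable_pi_lambda _ fun i => measurable_pi_lambda _ fun j => ?_
  simp only [standardize, Matrix.of_apply]
  have hentry : ∀ i, Measurable fun x : Fin n → Fin p → ℝ => x i j := fun i => by fun_prop
  have hmean : Measurable fun x : Fin n → Fin p → ℝ => (∑ l, x l j) / n :=
    (Finset.measurable_sum _ fun l _ => hentry l).div_const _
  exact ((hentry i).sub hmean).div
    ((Finset.measurable_sum _ fun l _ => ((hentry l).sub hmean).pow_const 2).div_const _).sqrt

variable {X : (n : ℕ) → Ω → Matrix (Fin n) (Fin p) ℝ}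

lemma exists_measurable_design
    (hX : (∀ n ω, X n ω = sampleMatrix Z n ω) ∨ (∀ n ω, X n ω = standardize (sampleMatrix Z n ω)))
    (n : ℕ) :
    ∃ x : (ℕ → Fin p → ℝ) → Fin n → Fin p → ℝ, Measurable x ∧
      (fun ω i j => X n ω i j) = fun ω => x fun i => Z i ω := by
  have hrows : Measurable fun (z : ℕ → Fin p → ℝ) (i : Fin n) => z i := by fun_prop
  rcases hX with hX | hX
  · exact ⟨_, hrows, funext fun ω => hX n ω⟩
  · exact ⟨_, measurable_standardize.comp hrows, funext fun ω => hX n ω⟩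

variable [MeasurableSpace Ω] {μ : Measure Ω}

lemma ae_tendsto_average {α : Type*} [MeasurableSpace α] {Z : ℕ → Ω → α}
    (hindep : iIndepFun Z μ) (hident : ∀ i, IdentDistrib (Z i) (Z 0) μ μ) {f : α → ℝ}
    (hf : Measurable f) (hint : Integrable (fun ω => f (Z 0 ω)) μ) :
    ∀ᵐ ω ∂μ, Tendsto (fun n : ℕ => (∑ i : Fin n, f (Z i ω)) / n) atTop
      (𝓝 (∫ ω, f (Z 0 ω) ∂μ)) := by
  have hlln := strong_law_ae_real (fun i ω => f (Z i ω)) hint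
    (fun i j hij => (hindep.indepFun hij).comp hf hf) fun i => (hident i).comp hf
  simpa only [Finset.sum_range] using hlln

lemma ae_tendsto_gram_sampleMatrix (hindep : iIndepFun Z μ)
    (hident : ∀ i, IdentDistrib (Z i) (Z 0) μ μ) (hL2 : ∀ j, MemLp (fun ω => Z 0 ω j) 2 μ)
    (hmean : ∀ j, ∫ ω, Z 0 ω j ∂μ = 0) (j k : Fin p) :
    ∀ᵐ ω ∂μ, Tendsto (fun n => gram (sampleMatrix Z n ω) j k) atTop
      (𝓝 (covMatrix μ (Z 0) j k)) := by
  have := hindep.isProbabilityMeasure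
  have hcov : ∫ ω, Z 0 ω j * Z 0 ω k ∂μ = covMatrix μ (Z 0) j k := by
    rw [covMatrix, Matrix.of_apply, covariance_eq_sub (hL2 j) (hL2 k), hmean, zero_mul, sub_zero]
    rfl
  simp only [gram_apply, sampleMatrix, Matrix.of_apply, ← hcov]
  exact ae_tendsto_average hindep hident (f := fun z => z j * z k) (by fun_prop)
    ((hL2 j).integrable_mul (hL2 k))

lemma ae_tendsto_gram_standardize (hindep : iIndepFun Z μ)
    (hident : ∀ i, IdentDistrib (Z i) (Z 0) μ μ) (hL2 : ∀ j, MemLp (fun ω => Z 0 ω j) 2 μ)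
    (hmean : ∀ j, ∫ ω, Z 0 ω j ∂μ = 0) (hdiag : ∀ j, covMatrix μ (Z 0) j j = 1) (j k : Fin p) :
    ∀ᵐ ω ∂μ, Tendsto (fun n => gram (standardize (sampleMatrix Z n ω)) j k) atTop
      (𝓝 (covMatrix μ (Z 0) j k)) := by
  have := hindep.isProbabilityMeasure
  have havg : ∀ j, ∀ᵐ ω ∂μ, Tendsto (fun n : ℕ => (∑ i, sampleMatrix Z n ω i j) / n) atTop
      (𝓝 0) := fun j => by
    rw [← hmean j]
    exact ae_tendsto_average hindep hident (f := fun z => z j) (measurable_pi_apply j)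
      ((hL2 j).integrable one_le_two)
  have hgram := ae_tendsto_gram_sampleMatrix hindep hident hL2 hmean
  filter_upwards [havg j, havg k, hgram j k, hgram j j, hgram k k] with ω hj hk hjk hjj hkk
  have hlim := (hjk.sub (hj.mul hk)).div
    ((hjj.sub (hj.mul hj)).sqrt.mul (hkk.sub (hk.mul hk)).sqrt) (by simp [hdiag])
  simp only [hdiag, mul_zero, sub_zero, Real.sqrt_one, mul_one, div_one] at hlim
  simp only [gram_standardize]
  exact hlim

lemma measurable_design
    (hX : (∀ n ω, X n ω = sampleMatrix Z n ω) ∨ (∀ n ω, X n ω = standardize (sampleMatrix Z n ω)))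
    (hZ : ∀ i, Measurable (Z i)) (n : ℕ) : Measurable fun ω i j => X n ω i j := by
  obtain ⟨x, hx, hXx⟩ := exists_measurable_design hX n
  rw [hXx]
  exact hx.comp (measurable_pi_lambda _ hZ)

lemma indepFun_design_noise
    (hX : (∀ n ω, X n ω = sampleMatrix Z n ω) ∨ (∀ n ω, X n ω = standardize (sampleMatrix Z n ω)))
    {ε : ℕ → Ω → ℝ} (hZε : IndepFun (fun ω i => Z i ω) (fun ω i => ε i ω) μ) (n : ℕ) :
    IndepFun (fun ω i j => X n ω i j) (fun ω (i : Fin n) => ε i ω) μ := by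
  obtain ⟨x, hx, hXx⟩ := exists_measurable_design hX n
  rw [hXx]
  exact hZε.comp hx (ψ := fun (e : ℕ → ℝ) (i : Fin n) => e i) (by fun_prop)

lemma tendstoInMeasure_gram_design
    (hX : (∀ n ω, X n ω = sampleMatrix Z n ω) ∨ (∀ n ω, X n ω = standardize (sampleMatrix Z n ω)))
    (hZ : ∀ i, Measurable (Z i)) (hindep : iIndepFun Z μ)
    (hident : ∀ i, IdentDistrib (Z i) (Z 0) μ μ) (hL2 : ∀ j, MemLp (fun ω => Z 0 ω j) 2 μ)
    (hmean : ∀ j, ∫ ω, Z 0 ω j ∂μ = 0) (hdiag : ∀ j, covMatrix μ (Z 0) j j = 1) (j k : Fin p) :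
    TendstoInMeasure μ (fun n ω => gram (X n ω) j k) atTop fun _ => covMatrix μ (Z 0) j k := by
  have := hindep.isProbabilityMeasure
  refine tendstoInMeasure_of_tendsto_ae (fun n => Measurable.aestronglyMeasurable ?_) ?_
  · exact measurable_pi_iff.1 (measurable_pi_iff.1
      (measurable_gram.comp (measurable_design hX hZ n)) j) k
  · rcases hX with hX | hX
    · simpa only [hX] using ae_tendsto_gram_sampleMatrix hindep hident hL2 hmean j k
    · simpa only [hX] using ae_tendsto_gram_standardize hindep hident hL2 hmean hdiag j k

lemma tendstoInMeasure_of_sqrt_mul_iSup_abs_sub {κ : Type*} [Finite κ] {f : ℕ → Ω → κ → ℝ}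
    {a : κ → ℝ} (h : TendstoInMeasure μ (fun (n : ℕ) ω => √(n : ℝ) * ⨆ k, |f n ω k - a k|) atTop
      fun _ => (0 : ℝ)) (k : κ) :
    TendstoInMeasure μ (fun n ω => f n ω k) atTop fun _ => a k := by
  rw [tendstoInMeasure_iff_dist] at h ⊢
  intro r hr
  refine tendsto_of_tendsto_of_tendsto_of_le_of_le' tendsto_const_nhds (h r hr)
    (Eventually.of_forall fun _ => zero_le) ?_
  filter_upwards [eventually_ge_atTop 1] with n hn
  refine measure_mono fun ω (hω : r ≤ |f n ω k - a k|) => hω.trans ?_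
  have hsup : |f n ω k - a k| ≤ ⨆ k, |f n ω k - a k| :=
    le_ciSup (f := fun k => |f n ω k - a k|) (Set.finite_range _).bddAbove k
  have hsqrt : 1 ≤ √(n : ℝ) := Real.one_le_sqrt.2 (by exact_mod_cast hn)
  rw [Real.dist_0_eq_abs]
  exact (hsup.trans (le_mul_of_one_le_left ((abs_nonneg _).trans hsup) hsqrt)).trans
    (le_abs_self _)

end Design

end SPAC

theorem theorem2_general {Ω : Type*} [MeasurableSpace Ω] (μ : Measure Ω) [IsProbabilityMeasure μ]
    (p q : ℕ) (C : Matrix (Fin p) (Fin p) ℝ) (hC : C.PosDef)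
    (X : (n : ℕ) → Ω → Matrix (Fin n) (Fin p) ℝ)
    (hXmeas : ∀ n, Measurable fun ω i j => X n ω i j)
    (hgram : ∀ j k, TendstoInMeasure μ (fun n ω => SPAC.gram (X n ω) j k) atTop fun _ => C j k)
    (e : (n : ℕ) → Ω → Fin n → ℝ) (hemeas : ∀ n, Measurable (e n))
    (hXe : ∀ n, IndepFun (fun ω i j => X n ω i j) (e n) μ)
    (c : ℝ≥0∞) (hc : c ≠ 0)
    (he : ∀ n, ∀ a : Fin n → ℝ, a ≠ 0 → c ≤ μ {ω | 0 < a ⬝ᵥ e n ω})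
    (β : Fin p → ℝ) (hβ : ∀ j : Fin p, ¬ (j : ℕ) < q → β j = 0)
    (y : (n : ℕ) → Ω → Fin n → ℝ) (hy : ∀ n ω, y n ω = X n ω *ᵥ β + e n ω)
    (γ : Fin p → ℝ) (hγ : ∀ j, γ j ≠ 0 ↔ (j : ℕ) < q)
    (dh : ℕ → Ω → Fin p → ℝ)
    (hd : ∀ j, TendstoInMeasure μ (fun n ω => dh n ω j) atTop fun _ => C⁻¹ j j)
    (hcons : SPAC.GeneralSignConsistent μ X y dh γ) :
    SPAC.WeakIrrepresentable q C γ := by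
  rw [SPAC.weakIrrepresentable_iff hC]
  by_contra hviol
  simp only [not_forall, not_le] at hviol
  obtain ⟨j, hj, hlt⟩ := hviol
  obtain ⟨σ, hσ, hmem⟩ := SPAC.exists_sign_mem_violationSet hC hlt
  set V := SPAC.violationSet (fun k : Fin p => (k : ℕ) < q) j (fun k => Real.sign (γ k)) σ
  set u : (n : ℕ) → Ω → Fin n → ℝ := fun n ω =>
    σ • SPAC.regResidual (fun k : Fin p => (k : ℕ) < q) j (X n ω)
  have hgram' : SPAC.TendstoInProb μ (fun n ω => SPAC.gram (X n ω)) atTop C :=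
    SPAC.tendstoInProb_pi fun j => SPAC.tendstoInProb_pi fun k =>
      SPAC.tendstoInProb_of_tendstoInMeasure (hgram j k)
  have hbad : Tendsto (fun n => μ {ω | (SPAC.gram (X n ω), dh n ω) ∉ V}) atTop (𝓝 0) :=
    hgram'.prodMk (SPAC.tendstoInProb_pi fun j =>
      SPAC.tendstoInProb_of_tendstoInMeasure (hd j)) V (SPAC.violationSet_mem_nhds hmem)
  have humeas : ∀ n, Measurable (u n) := fun n =>
    (SPAC.measurable_regResidual.comp (hXmeas n)).const_smul σ
  have hue : ∀ n, IndepFun (u n) (e n) μ := fun n =>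
    (hXe n).comp (SPAC.measurable_regResidual.const_smul σ) measurable_id
  have hpos : Tendsto (fun n => μ {ω | 0 < u n ω ⬝ᵥ e n ω}) atTop (𝓝 0) := by
    refine SPAC.tendsto_measure_zero_of_inter
      (fun n => (humeas n).prodMk (hemeas n) SPAC.measurableSet_dotProduct_pos) hcons ?_
    refine SPAC.tendsto_measure_zero_mono hbad ?_
    rintro n ω ⟨⟨lam, hlam, g, hlasso, hsign⟩, hlt⟩ hV
    rw [hy] at hlasso
    exact hlt.not_ge (SPAC.dotProduct_noise_nonpos_of_mem_violationSet hβ hγ hj hσ hV hlam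
      hlasso hsign)
  have hne : Tendsto (fun n => μ {ω | u n ω ≠ 0}) atTop (𝓝 1) := by
    refine SPAC.tendsto_measure_one_of_compl_subset hbad fun n ω h0 hV => h0 ?_
    exact smul_ne_zero (abs_ne_zero.1 (hσ ▸ one_ne_zero))
      (SPAC.regResidual_ne_zero (j := j) hj hV.2.1)
  have hle := le_of_tendsto_of_tendsto' (ENNReal.Tendsto.const_mul hne (Or.inl one_ne_zero)) hpos
    fun n => SPAC.mul_measure_ne_zero_le_of_indepFun (humeas n) (hemeas n) (hue n) (he n)
  exact hc (by simpa using hle)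

theorem theorem2 {Ω : Type*} [MeasurableSpace Ω] (μ : Measure Ω) [IsProbabilityMeasure μ]
    (p q : ℕ) (hq : 1 ≤ q) (hqp : q ≤ p)
    -- independent copies of the covariate vector: mean zero, covariance matrix `C`
    (C : Matrix (Fin p) (Fin p) ℝ) (hCpos : C.PosDef) (hCdiag : ∀ j, C j j = 1)
    (Z : ℕ → Ω → Fin p → ℝ) (hZmeas : ∀ i, Measurable (Z i)) (hZindep : iIndepFun Z μ)
    (hZident : ∀ i, IdentDistrib (Z i) (Z 0) μ μ)
    (hZL2 : ∀ j, MemLp (fun ω => Z 0 ω j) 2 μ)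
    (hZmean : ∀ j, ∫ ω, Z 0 ω j ∂μ = 0)
    (hZcov : SPAC.covMatrix μ (Z 0) = C)
    -- Gaussian errors with positive variance `v`, independent of the covariates
    (v : ℝ≥0) (hv : 0 < v)
    (ε : ℕ → Ω → ℝ) (hεmeas : ∀ i, Measurable (ε i)) (hεindep : iIndepFun ε μ)
    (hεlaw : ∀ i, μ.map (ε i) = gaussianReal 0 v)
    (hZε : IndepFun (fun ω i => Z i ω) (fun ω i => ε i ω) μ)
    -- exactly the first `q` coefficients are nonzero
    (β : Fin p → ℝ) (hβ : ∀ j, β j ≠ 0 ↔ (j : ℕ) < q)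
    -- the vector of SPACs between `Y = 𝒳 β + ε` and the covariates
    (γ : Fin p → ℝ)
    (hγ : ∀ j, γ j = SPAC.spac μ (Z 0) (fun ω => ∑ k, Z 0 ω k * β k + ε 0 ω) j)
    -- the design matrices: the samples themselves, or the samples standardized by columns
    (X : (n : ℕ) → Ω → Matrix (Fin n) (Fin p) ℝ)
    (hX : (∀ n ω, X n ω = SPAC.sampleMatrix Z n ω) ∨
      (∀ n ω, X n ω = SPAC.standardize (SPAC.sampleMatrix Z n ω)))
    (y : (n : ℕ) → Ω → Fin n → ℝ)
    (hy : ∀ n ω i, y n ω i = ∑ j, X n ω i j * β j + ε i ω)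
    -- the maximal squared row norm is `o_p(n)`
    (hC3 : TendstoInMeasure μ (fun (n : ℕ) ω => (⨆ i, ∑ j, X n ω i j ^ 2) / (n : ℝ)) atTop
      (fun _ => (0 : ℝ)))
    -- the estimators of the diagonal of `C⁻¹`, with maximal error `o_p(1 / √n)`
    (dh : ℕ → Ω → Fin p → ℝ) (hdmeas : ∀ n, Measurable (dh n))
    (hd : TendstoInMeasure μ (fun (n : ℕ) ω => √(n : ℝ) * ⨆ j, |dh n ω j - (C⁻¹) j j|) atTop
      (fun _ => (0 : ℝ)))
    (hcons : SPAC.GeneralSignConsistent μ X y dh γ) :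
    SPAC.WeakIrrepresentable q C γ := by
  subst hZcov
  have hlaw : ∀ i, HasLaw (ε i) (gaussianReal 0 v) μ := fun i =>
    ⟨(hεmeas i).aemeasurable, hεlaw i⟩
  have hhalf : ∀ n, ∀ a : Fin n → ℝ, a ≠ 0 → 2⁻¹ ≤ μ {ω | 0 < a ⬝ᵥ fun i => ε i ω} :=
    fun n a ha => (SPAC.measure_dotProduct_pos_of_gaussian (hεindep.precomp Fin.val_injective)
      hv.ne' (fun i => hlaw i) ha).ge
  have hactive : ∀ j, γ j ≠ 0 ↔ (j : ℕ) < q := fun j => by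
    rw [hγ, SPAC.spac_gaussian_ne_zero_iff hZL2 hCpos hv.ne' (hlaw 0)
      (hZε.comp (measurable_pi_apply 0) (measurable_pi_apply 0)), hβ]
  exact theorem2_general μ p q _ hCpos X (SPAC.measurable_design hX hZmeas)
    (SPAC.tendstoInMeasure_gram_design hX hZmeas hZindep hZident hZL2 hZmean hCdiag)
    (fun n ω i => ε i ω) (fun n => measurable_pi_lambda _ fun i => hεmeas i)
    (SPAC.indepFun_design_noise hX hZε) 2⁻¹ (by simp) hhalf
    β (fun j hj => not_not.1 (mt (hβ j).1 hj)) y (fun n ω => funext (hy n ω)) γ hactive dh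
    (SPAC.tendstoInMeasure_of_sqrt_mul_iSup_abs_sub hd) hcons
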